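/- Let $\tau$ be a random variable with values in $(0,\infty]$, with cumulative distribution function $F_\tau(t)=\mathbb{P}(\tau\le t)$, so that $F_\tau(0)=0$. Let $Y$ be independent of $\tau$ and exponentially distributed with unit mean, $\mathbb{P}(Y>y)=e^{-y}$ for $y\ge 0$. For a resetting rate $r>0$ let $\sigma=Y/r$ be the (exponential) resetting time and let $p=p(r)=\mathbb{P}(\tau<\sigma)$ be the probability that a search succeeds before it is reset. Let the search time with resetting be $$T=T(r)=\sum_{n=1}^{R}\sigma_n^-+\tau^-,$$ where $R$, $\{\sigma_n^-\}_{n\ge1}$ and $\tau^-$ are independent, $\mathbb{P}(R=n)=(1-p)^np$ for $n\in\{0,1,2,\dots\}$, the $\sigma_n^-$ are independent and identically distributed with $\mathbb{P}(\sigma_n^->t)=\mathbb{P}(\sigma>t\mid\sigma<\tau)$, and $\mathbb{P}(\tau^->t)=\mathbb{P}(\tau>t\mid\tau<\sigma)$. If $$\lim_{t\to0^+}t\ln F_\tau(t)=-C<0,$$ then $$\ln p\sim-\sqrt{4Cr}\quad\text{as }r\to\infty,$$ and, for every integer $m\ge1$, the moment $\mathbb{E}[T^m]$ is finite for all $r>0$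 and $$\ln\big(r^m\,\mathbb{E}[T^m]\big)\sim m\sqrt{4Cr}\quad\text{as }r\to\infty.$$ Here $f\sim g$ as $r\to\infty$ means that $f(r)/g(r)\to1$. -/

import Mathlib

open MeasureTheory ProbabilityTheory Filter Topology Asymptotics

namespace StochasticResetting

/-- Cumulative distribution function `F_τ(t) = ℙ(τ ≤ t)` of a random time `τ` which is allowed to
be infinite. -/
noncomputable def cdfTime {Ω : Type*} [MeasurableSpace Ω] (P : Measure Ω) (τ : Ω → EReal)
    (t : ℝ) : ℝ :=
  P.real {ω | τ ω ≤ (t : EReal)}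

/-- The resetting time `σ = Y / r` with resetting rate `r`. -/
noncomputable def resetTime {Ω : Type*} (Y : Ω → ℝ) (r : ℝ) (ω : Ω) : ℝ :=
  Y ω / r

/-- Probability `ℙ(τ < σ)` that the search succeeds before the reset. -/
noncomputable def successProb {Ω : Type*} [MeasurableSpace Ω] (P : Measure Ω) (τ : Ω → EReal)
    (σ : Ω → ℝ) : ℝ :=
  P.real {ω | τ ω < (σ ω : EReal)}

/-- `R`, `(σm n)` and `τm` are, on a probability space with measure `Q`, the ingredients of the
search with resetting built from `(τ, σ)`: the number `R` of resets is geometric with success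
probability `ℙ(τ < σ)`; the `σm n` (durations of the unsuccessful searches) are i.i.d. with the law
of `σ` given `σ < τ`; `τm` (duration of the successful search) has the law of `τ` given `τ < σ`;
and `R`, the sequence `(σm n)` and `τm` are independent. -/
structure IsResetSearch {Ω₀ Ω : Type*} [MeasurableSpace Ω₀] [MeasurableSpace Ω]
    (P : Measure Ω₀) (τ : Ω₀ → EReal) (σ : Ω₀ → ℝ) (Q : Measure Ω)
    (R : Ω → ℕ) (σm : ℕ → Ω → ℝ) (τm : Ω → ℝ) : Prop where
  measurable_R : Measurable R
  measurable_σm : ∀ n, Measurable (σm n)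
  measurable_τm : Measurable τm
  law_R : ∀ n : ℕ, Q.real {ω | R ω = n} = (1 - successProb P τ σ) ^ n * successProb P τ σ
  law_σm : ∀ (n : ℕ) (t : ℝ), Q {ω | t < σm n ω} =
    ProbabilityTheory.cond P {ω | (σ ω : EReal) < τ ω} {ω | t < σ ω}
  law_τm : ∀ t : ℝ, Q {ω | t < τm ω} =
    ProbabilityTheory.cond P {ω | τ ω < (σ ω : EReal)} {ω | (t : EReal) < τ ω}
  indep_σm : iIndepFun σm Q
  indep_σm_τm : IndepFun (fun ω n => σm n ω) τm Q
  indep_R : IndepFun R (fun ω => ((fun n => σm n ω : ℕ → ℝ), τm ω)) Q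

/-- The first passage time with resetting: the sum of the durations of the `R` unsuccessful
searches plus the duration of the successful one. -/
noncomputable def totalTime {Ω : Type*} (R : Ω → ℕ) (σm : ℕ → Ω → ℝ) (τm : Ω → ℝ) (ω : Ω) : ℝ :=
  (∑ n ∈ Finset.range (R ω), σm n ω) + τm ω

end StochasticResetting

/-! By independence `p` is the Laplace transform of `τ` at `r`, and `F t` behaves like `exp (-C/t)`
near `0`, so `ln p` is governed by the minimum of `C/t + r t`, namely `2√(C r)` at `t = √(C/r)`. The
lower bound on `p` keeps this single `t`: `F t * exp (-r t) ≤ p`. The upper bound slices by `⌊r τ⌋`;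
by AM-GM each slice is at most `exp (1 - 2√(c r))` for a fixed `c < C`, and there are only `O(r)`
slices, which the logarithm does not see at scale `√r` (`tendsto_log_div_sqrt`). For the moments,
`r^m E[T^m]` lies between constant multiples of `p^(-m)` for large `r` (`IsResetSearch.moments`).
Above, this uses convexity of `x^m`, exponential tails of the summands and the moments of the
geometric `R`; below, Jensen and Wald, `E[T] ≥ E[R] E[σ⁻]`. The constants stay bounded because the
probability `q` of a reset tends to `1`, and after taking logarithms they disappear against `√r`. -/

namespace StochasticResetting

/-! ### Asymptotics of `log p` from the behaviour of `F` at `0⁺`. -/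

/-- Lower estimate for a Laplace transform-like quantity `p` of a function with
`t * log (F t) → -C`. -/
theorem eventually_lt_log_div_sqrt {F p : ℝ → ℝ} {C : ℝ} (hC : 0 < C)
    (hlim : Tendsto (fun t : ℝ => t * Real.log (F t)) (𝓝[>] 0) (𝓝 (-C)))
    (hFpos : ∀ t, 0 < t → 0 < F t)
    (hlow : ∀ r t : ℝ, 0 < r → 0 < t → F t * Real.exp (-(r * t)) ≤ p r)
    {b : ℝ} (hb : b < -(2 * √C)) :
    ∀ᶠ r in atTop, b < Real.log (p r) / √r := by
  have hsC : 0 < √C := Real.sqrt_pos.2 hC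
  -- `√C / √r` minimises `C / t + r * t`; at this point `log F` and `-r t` each contribute `-√C`
  -- after division by `√r`.
  have ht : Tendsto (fun r : ℝ => √C / √r) atTop (𝓝[>] 0) := by
    refine tendsto_nhdsWithin_iff.2 ⟨?_, ?_⟩
    · exact Tendsto.const_div_atTop Real.tendsto_sqrt_atTop _
    · filter_upwards [eventually_gt_atTop 0] with r hr
      exact div_pos hsC (Real.sqrt_pos.2 hr)
  have h1 : Tendsto (fun r : ℝ => (√C / √r * Real.log (F (√C / √r))) / √C - √C) atTop
      (𝓝 (-C / √C - √C)) := ((hlim.comp ht).div_const _).sub_const _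
  have h2 : -C / √C - √C = -(2 * √C) := by
    have : C / √C = √C := Real.div_sqrt
    rw [neg_div, this]; ring
  rw [h2] at h1
  filter_upwards [h1.eventually (lt_mem_nhds hb), eventually_gt_atTop 0] with r hr hr0
  refine hr.trans_le ?_
  have hsr : 0 < √r := Real.sqrt_pos.2 hr0
  have htp : 0 < √C / √r := div_pos hsC hsr
  have hl := Real.log_le_log (mul_pos (hFpos _ htp) (Real.exp_pos _)) (hlow r _ hr0 htp)
  rw [Real.log_mul (hFpos _ htp).ne' (Real.exp_pos _).ne', Real.log_exp] at hl
  rw [le_div_iff₀ hsr]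
  refine le_trans (le_of_eq ?_) hl
  have : r = √r * √r := (Real.mul_self_sqrt hr0.le).symm
  have h3 : r * (√C / √r) = √r * √C := by
    nth_rw 1 [this]; field_simp
  rw [h3]
  field_simp
  ring

theorem eventually_log_div_sqrt_lt {F p : ℝ → ℝ} {C : ℝ} (hC : 0 < C)
    (hlim : Tendsto (fun t : ℝ => t * Real.log (F t)) (𝓝[>] 0) (𝓝 (-C)))
    (hFpos : ∀ t, 0 < t → 0 < F t)
    (hp : ∀ r, 0 < r → 0 < p r)
    (hup : ∀ (r : ℝ) (N : ℕ), 0 < r → p r ≤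
      (∑ k ∈ Finset.range N, F ((k + 1) / r) * Real.exp (-k)) + Real.exp (-N))
    {a : ℝ} (ha : -(2 * √C) < a) :
    ∀ᶠ r in atTop, Real.log (p r) / √r < a := by
  -- The gap between `c` and `C` turns the limit into the pointwise bound `F t ≤ exp (-c/t)` near
  -- `0`; continuity of `√` keeps `-2√c` below `a`.
  obtain ⟨c, hca, hc0, hcC⟩ : ∃ c : ℝ, -(2 * √c) < a ∧ 0 < c ∧ c < C := by
    have h1 : Tendsto (fun c : ℝ => -(2 * √c)) (𝓝[<] C) (𝓝 (-(2 * √C))) :=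
      (Continuous.tendsto (by fun_prop) C).mono_left nhdsWithin_le_nhds
    have h2 : ∀ᶠ c in 𝓝[<] C, 0 < c := nhdsWithin_le_nhds (lt_mem_nhds hC)
    exact ((h1.eventually (gt_mem_nhds ha)).and (h2.and self_mem_nhdsWithin)).exists
  obtain ⟨δ, hδ0, hδ⟩ : ∃ δ : ℝ, 0 < δ ∧ ∀ t, 0 < t → t ≤ δ → F t ≤ Real.exp (-(c / t)) := by
    have h1 := hlim.eventually (gt_mem_nhds (neg_lt_neg hcC))
    obtain ⟨u, hu, hsub⟩ := mem_nhdsGT_iff_exists_Ioc_subset.1 h1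
    refine ⟨u, hu, fun t ht htu => ?_⟩
    have h2 : t * Real.log (F t) < -c := hsub ⟨ht, htu⟩
    rw [← Real.log_le_iff_le_exp (hFpos t ht), ← neg_div, le_div_iff₀ ht]
    linarith
  have hbound : ∀ r : ℝ, 0 < r → 2 * √c / δ ≤ √r →
      Real.log (p r) ≤ 1 + Real.log (r * δ + 1) - 2 * √c * √r := by
    intro r hr hrc
    have hsr : 0 < √r := Real.sqrt_pos.2 hr
    have hrr : √r * √r = r := Real.mul_self_sqrt hr.le
    have hcc : √c * √c = c := Real.mul_self_sqrt hc0.le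
    -- The largest number of slices for which every point `(k+1)/r` stays in `(0, δ]`.
    set N := ⌊r * δ⌋₊ with hN
    have hN1 : (N : ℝ) ≤ r * δ := Nat.floor_le (by positivity)
    have hN2 : r * δ < N + 1 := Nat.lt_floor_add_one _
    have hterm : ∀ k ∈ Finset.range N,
        F ((k + 1) / r) * Real.exp (-k) ≤ Real.exp (1 - 2 * √c * √r) := by
      intro k hk
      have hkN : (k : ℝ) + 1 ≤ N := by exact_mod_cast Finset.mem_range.1 hk
      have ht0 : 0 < ((k : ℝ) + 1) / r := by positivity
      have htδ : ((k : ℝ) + 1) / r ≤ δ := by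
        rw [div_le_iff₀ hr]; linarith
      refine (mul_le_mul_of_nonneg_right (hδ _ ht0 htδ) (Real.exp_pos _).le).trans ?_
      rw [← Real.exp_add]
      apply Real.exp_le_exp.2
      have hk1 : (0 : ℝ) < k + 1 := by positivity
      -- AM-GM. The weight is `exp (-k)` and not `exp (-(k+1))`, which costs the `1` in the
      -- exponent.
      have h4 : 2 * √c * √r ≤ c / ((k + 1) / r) + (k + 1) := by
        rw [div_div_eq_mul_div, ← sub_nonneg]
        have : c * r / (k + 1) + (k + 1) - 2 * √c * √r
            = (√c * √r - (k + 1)) ^ 2 / (k + 1) := by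
          field_simp
          nlinarith [hrr, hcc]
        rw [this]; positivity
      linarith
    have hlast : Real.exp (-N) ≤ Real.exp (1 - 2 * √c * √r) := by
      apply Real.exp_le_exp.2
      rw [div_le_iff₀ hδ0] at hrc
      have : 2 * √c * √r ≤ r * δ := by
        calc 2 * √c * √r ≤ (√r * δ) * √r := by gcongr
          _ = r * δ := by rw [mul_right_comm, hrr]
      linarith
    have hsum : p r ≤ (r * δ + 1) * Real.exp (1 - 2 * √c * √r) := by
      refine (hup r N hr).trans ?_
      have h5 := Finset.sum_le_sum hterm
      rw [Finset.sum_const, Finset.card_range, nsmul_eq_mul] at h5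
      have h6 : (N : ℝ) * Real.exp (1 - 2 * √c * √r) ≤ r * δ * Real.exp (1 - 2 * √c * √r) := by
        gcongr
      linarith
    have h7 := Real.log_le_log (hp r hr) hsum
    rw [Real.log_mul (by positivity) (Real.exp_pos _).ne', Real.log_exp] at h7
    linarith
  have hlog : Tendsto (fun r : ℝ => (1 + Real.log (r * δ + 1)) / √r - 2 * √c) atTop
      (𝓝 (0 - 2 * √c)) := by
    refine Tendsto.sub_const ?_ _
    have h1 : Tendsto (fun r : ℝ => r * δ + 1) atTop atTop :=
      tendsto_atTop_add_const_right _ _ (tendsto_id.atTop_mul_const hδ0)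
    have h2 : (fun r : ℝ => Real.log (r * δ + 1)) =o[atTop] (fun r : ℝ => √r) := by
      have h3 : (fun r : ℝ => Real.log (r * δ + 1)) =o[atTop]
          (fun r : ℝ => (r * δ + 1) ^ (1 / 2 : ℝ)) :=
        (isLittleO_log_rpow_atTop (by norm_num : (0 : ℝ) < 1 / 2)).comp_tendsto h1
      refine h3.trans_isBigO (IsBigO.of_bound (√(δ + 1)) ?_)
      filter_upwards [eventually_ge_atTop 1] with r hr
      rw [← Real.sqrt_eq_rpow, Real.norm_of_nonneg (Real.sqrt_nonneg _),
        Real.norm_of_nonneg (Real.sqrt_nonneg _), ← Real.sqrt_mul (by positivity)]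
      exact Real.sqrt_le_sqrt (by nlinarith)
    have h4 : (fun _ : ℝ => (1 : ℝ)) =o[atTop] (fun r : ℝ => √r) :=
      (isLittleO_const_left).2 (Or.inr
        (tendsto_norm_atTop_atTop.comp Real.tendsto_sqrt_atTop))
    exact (h4.add h2).tendsto_div_nhds_zero
  rw [zero_sub] at hlog
  filter_upwards [hlog.eventually (gt_mem_nhds hca), eventually_gt_atTop 0,
    Real.tendsto_sqrt_atTop.eventually_ge_atTop (2 * √c / δ)] with r h1 h2 h3
  refine lt_of_le_of_lt ?_ h1
  have hsr : 0 < √r := Real.sqrt_pos.2 h2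
  rw [div_le_iff₀ hsr, sub_mul, div_mul_cancel₀ _ hsr.ne']
  exact hbound r h2 h3

theorem tendsto_log_div_sqrt {F p : ℝ → ℝ} {C : ℝ} (hC : 0 < C)
    (hlim : Tendsto (fun t : ℝ => t * Real.log (F t)) (𝓝[>] 0) (𝓝 (-C)))
    (hFpos : ∀ t, 0 < t → 0 < F t)
    (hlow : ∀ r t : ℝ, 0 < r → 0 < t → F t * Real.exp (-(r * t)) ≤ p r)
    (hup : ∀ (r : ℝ) (N : ℕ), 0 < r → p r ≤
      (∑ k ∈ Finset.range N, F ((k + 1) / r) * Real.exp (-k)) + Real.exp (-N)) :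
    Tendsto (fun r => Real.log (p r) / √r) atTop (𝓝 (-(2 * √C))) := by
  have hp : ∀ r, 0 < r → 0 < p r := fun r hr =>
    (mul_pos (hFpos 1 one_pos) (Real.exp_pos _)).trans_le (hlow r 1 hr one_pos)
  exact tendsto_order.2 ⟨fun b hb => eventually_lt_log_div_sqrt hC hlim hFpos hlow hb,
    fun a ha => eventually_log_div_sqrt_lt hC hlim hFpos hp hup ha⟩

/-- A monotone nonnegative function with `t * log (F t) → -C < 0` at `0⁺` is positive on
`(0, ∞)`. -/
theorem pos_of_tendsto_mul_log {F : ℝ → ℝ} {C : ℝ} (hC : 0 < C) (hmono : Monotone F)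
    (hF : ∀ t, 0 ≤ F t)
    (hlim : Tendsto (fun t : ℝ => t * Real.log (F t)) (𝓝[>] 0) (𝓝 (-C)))
    {t : ℝ} (ht : 0 < t) : 0 < F t := by
  have h1 := hlim.eventually (gt_mem_nhds (neg_lt_zero.2 hC))
  obtain ⟨s, hs, hs0, hst⟩ := (h1.and (Ioo_mem_nhdsGT ht)).exists
  refine lt_of_lt_of_le ((hF s).lt_of_ne fun h => ?_) (hmono hst.le)
  -- If `F s = 0`, the convention `log 0 = 0` makes the product `0`, contradicting its negativity.
  rw [← h] at hs
  simp at hs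

/-! ### Bounds on the success probability in terms of the distribution function. -/

section SuccessProb

variable {Ω₀ : Type*} [MeasurableSpace Ω₀] {P : Measure Ω₀}
  {τ : Ω₀ → EReal} {Y : Ω₀ → ℝ}

theorem cdfTime_mono [IsProbabilityMeasure P] : Monotone (cdfTime P τ) := fun _ _ hst =>
  measureReal_mono fun _ hω => le_trans hω (EReal.coe_le_coe_iff.2 hst)

theorem measureReal_resetTime_gt (hYexp : ∀ y : ℝ, 0 ≤ y → P.real {ω | y < Y ω} = Real.exp (-y))
    {r t : ℝ} (hr : 0 < r) (ht : 0 ≤ t) :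
    P.real {ω | t < resetTime Y r ω} = Real.exp (-(r * t)) := by
  rw [← hYexp (r * t) (by positivity)]
  congr 1
  ext ω
  simp only [Set.mem_ofPred_eq, resetTime]
  rw [lt_div_iff₀ hr, mul_comm]

theorem measureReal_le_inter_gt (hτY : IndepFun τ Y P)
    (hYexp : ∀ y : ℝ, 0 ≤ y → P.real {ω | y < Y ω} = Real.exp (-y)) {t y : ℝ} (hy : 0 ≤ y) :
    P.real ({ω | τ ω ≤ (t : EReal)} ∩ {ω | y < Y ω}) = cdfTime P τ t * Real.exp (-y) := by
  have h := hτY.measure_inter_preimage_eq_mul (Set.Iic (t : EReal)) (Set.Ioi y)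
    measurableSet_Iic measurableSet_Ioi
  rw [← hYexp y hy, cdfTime, measureReal_def, measureReal_def, measureReal_def,
    ← ENNReal.toReal_mul]
  exact congrArg ENNReal.toReal h

theorem cdfTime_mul_exp_le_successProb [IsProbabilityMeasure P] (hτY : IndepFun τ Y P)
    (hYexp : ∀ y : ℝ, 0 ≤ y → P.real {ω | y < Y ω} = Real.exp (-y)) {r t : ℝ} (hr : 0 < r)
    (ht : 0 < t) :
    cdfTime P τ t * Real.exp (-(r * t)) ≤ successProb P τ (resetTime Y r) := by
  rw [← measureReal_le_inter_gt hτY hYexp (by positivity : 0 ≤ r * t)]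
  refine measureReal_mono ?_
  rintro ω ⟨h1, h2⟩
  refine lt_of_le_of_lt h1 (EReal.coe_lt_coe_iff.2 ?_)
  rw [resetTime, lt_div_iff₀ hr, mul_comm]
  exact h2

/-- If `0 < τ < σ` then `τ` is finite, and with `k = ⌊r τ⌋` both `τ ≤ (k+1)/r` and `Y > k` hold;
independence splits each slice, and all slices with `k ≥ N` lie in `Y > N`. -/
theorem successProb_le [IsProbabilityMeasure P] (hτY : IndepFun τ Y P) (hF0 : cdfTime P τ 0 = 0)
    (hYexp : ∀ y : ℝ, 0 ≤ y → P.real {ω | y < Y ω} = Real.exp (-y)) {r : ℝ} (N : ℕ)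
    (hr : 0 < r) :
    successProb P τ (resetTime Y r) ≤
      (∑ k ∈ Finset.range N, cdfTime P τ ((k + 1) / r) * Real.exp (-k)) + Real.exp (-N) := by
  have hsub : {ω | τ ω < (resetTime Y r ω : EReal)} ⊆
      ({ω | τ ω ≤ ((0 : ℝ) : EReal)} ∪ ⋃ k ∈ Finset.range N,
        ({ω | τ ω ≤ (((k + 1) / r : ℝ) : EReal)} ∩ {ω | (k : ℝ) < Y ω})) ∪
        {ω | (N : ℝ) < Y ω} := by
    intro ω hω
    simp only [Set.mem_ofPred_eq] at hω
    rcases le_or_gt (τ ω) ((0 : ℝ) : EReal) with h0 | h0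
    · exact Or.inl (Or.inl h0)
    obtain ⟨x, hx⟩ : ∃ x : ℝ, τ ω = x := by
      refine ⟨(τ ω).toReal, (EReal.coe_toReal hω.ne_top ?_).symm⟩
      exact (lt_of_le_of_lt bot_le h0).ne'
    rw [hx] at hω h0
    have hx0 : 0 < x := EReal.coe_lt_coe_iff.1 h0
    have hxY : x * r < Y ω := by
      have := EReal.coe_lt_coe_iff.1 hω
      rwa [resetTime, lt_div_iff₀ hr] at this
    have hk1 : (⌊x * r⌋₊ : ℝ) ≤ x * r := Nat.floor_le (by positivity)
    have hk2 : x * r < ⌊x * r⌋₊ + 1 := Nat.lt_floor_add_one _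
    rcases lt_or_ge ⌊x * r⌋₊ N with hk | hk
    · refine Or.inl (Or.inr ?_)
      simp only [Set.mem_iUnion]
      refine ⟨⌊x * r⌋₊, Finset.mem_range.2 hk, ?_, lt_of_le_of_lt hk1 hxY⟩
      simp only [Set.mem_ofPred_eq, hx]
      exact EReal.coe_le_coe_iff.2 ((le_div_iff₀ hr).2 hk2.le)
    · have : (N : ℝ) ≤ ⌊x * r⌋₊ := by exact_mod_cast hk
      exact Or.inr (lt_of_le_of_lt (this.trans hk1) hxY)
  refine (measureReal_mono hsub).trans ?_
  refine (measureReal_union_le _ _).trans ?_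
  rw [hYexp N (by positivity)]
  refine add_le_add ((measureReal_union_le _ _).trans ?_) le_rfl
  have h0 : P.real {ω | τ ω ≤ ((0 : ℝ) : EReal)} = 0 := hF0
  rw [h0, zero_add]
  refine (measureReal_biUnion_finset_le _ _).trans (Finset.sum_le_sum fun k _ => ?_)
  exact (measureReal_le_inter_gt hτY hYexp (by positivity)).le

end SuccessProb

end StochasticResetting

/-! ### Moments of a geometric random sum. -/

namespace StochasticResetting

theorem totalTime_nonneg {Ω : Type*} {R : Ω → ℕ} {s : ℕ → Ω → ℝ} {τm : Ω → ℝ} {ω : Ω}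
    (hs : ∀ i, 0 ≤ s i ω) (hτ : 0 ≤ τm ω) : 0 ≤ totalTime R s τm ω :=
  add_nonneg (Finset.sum_nonneg fun i _ => hs i) hτ

/-- The power mean inequality for `R + 1` summands, `τm` being the last one. -/
theorem totalTime_pow_le {Ω : Type*} {R : Ω → ℕ} {s : ℕ → Ω → ℝ} {τm : Ω → ℝ} {ω : Ω}
    (hs : ∀ i, 0 ≤ s i ω) (hτ : 0 ≤ τm ω) {m : ℕ} (hm : 1 ≤ m) :
    totalTime R s τm ω ^ m ≤
      ((R ω : ℝ) + 1) ^ (m - 1) * ((∑ i ∈ Finset.range (R ω), s i ω ^ m) + τm ω ^ m) := by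
  obtain ⟨k, rfl⟩ : ∃ k, m = k + 1 := ⟨m - 1, by omega⟩
  have h := pow_sum_div_card_le_sum_pow (s := Finset.range (R ω + 1))
    (f := fun i => if i < R ω then s i ω else τm ω)
    (fun i _ => by split_ifs <;> [exact hs i; exact hτ]) k
  have hsum : ∀ g : ℝ → ℝ, ∑ i ∈ Finset.range (R ω + 1), g (if i < R ω then s i ω else τm ω) =
      (∑ i ∈ Finset.range (R ω), g (s i ω)) + g (τm ω) := fun g => by
    rw [Finset.sum_range_succ, if_neg (lt_irrefl _)]
    congr 1
    exact Finset.sum_congr rfl fun i hi => by rw [if_pos (Finset.mem_range.1 hi)]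
  rw [hsum (fun x => x ^ (k + 1)), hsum (fun x => x), Finset.card_range,
    div_le_iff₀ (by positivity)] at h
  rw [Nat.add_sub_cancel, mul_comm]
  exact_mod_cast h

section Moments

open scoped ENNReal Nat

variable {Ω : Type*} [MeasurableSpace Ω] {Q : Measure Ω}

/-- Layer-cake formula followed by the Gamma integral. -/
theorem lintegral_pow_le_of_exponential_tail {X : Ω → ℝ} (hX : Measurable X)
    (hX0 : ∀ᵐ ω ∂Q, 0 ≤ X ω) {A r : ℝ} (hA : 0 ≤ A) (hr : 0 < r)
    (htail : ∀ t, 0 < t → Q {ω | t < X ω} ≤ ENNReal.ofReal (A * Real.exp (-(r * t))))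
    {m : ℕ} (hm : 1 ≤ m) :
    ∫⁻ ω, ENNReal.ofReal (X ω ^ m) ∂Q ≤ ENNReal.ofReal (A * m ! / r ^ m) := by
  have hm0 : (0 : ℝ) < m := by exact_mod_cast hm
  have hI := Real.integral_rpow_mul_exp_neg_mul_Ioi hm0 hr
  have hval : (0 : ℝ) < (1 / r) ^ (m : ℝ) * Real.Gamma m :=
    mul_pos (by positivity) (Real.Gamma_pos_of_pos hm0)
  have hint : IntegrableOn (fun t : ℝ => t ^ ((m : ℝ) - 1) * Real.exp (-(r * t)))
      (Set.Ioi 0) := by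
    -- A non-integrable function has integral `0` by convention, whereas the Gamma value is
    -- positive.
    by_contra h
    rw [integral_undef h] at hI
    exact hval.ne hI
  have h1 := lintegral_rpow_eq_lintegral_meas_lt_mul Q hX0 hX.aemeasurable hm0
  simp only [Real.rpow_natCast] at h1
  rw [h1]
  have h2 : ∫⁻ t in Set.Ioi (0 : ℝ), Q {ω | t < X ω} * ENNReal.ofReal (t ^ ((m : ℝ) - 1)) ≤
      ENNReal.ofReal (A * ((1 / r) ^ (m : ℝ) * Real.Gamma m)) := by
    calc ∫⁻ t in Set.Ioi (0 : ℝ), Q {ω | t < X ω} * ENNReal.ofReal (t ^ ((m : ℝ) - 1))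
        ≤ ∫⁻ t in Set.Ioi (0 : ℝ),
            ENNReal.ofReal (A * (t ^ ((m : ℝ) - 1) * Real.exp (-(r * t)))) := by
          refine setLIntegral_mono' measurableSet_Ioi fun t ht => ?_
          have ht0 : (0 : ℝ) < t := ht
          refine (mul_le_mul_left (htail t ht0) _).trans (le_of_eq ?_)
          rw [← ENNReal.ofReal_mul (by positivity)]
          congr 1; ring
      _ = ENNReal.ofReal (A * ((1 / r) ^ (m : ℝ) * Real.Gamma m)) := by
          rw [← ofReal_integral_eq_lintegral_ofReal (hint.const_mul A), integral_const_mul, hI]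
          refine (ae_restrict_iff' measurableSet_Ioi).2 (ae_of_all _ fun t ht => ?_)
          have ht0 : (0 : ℝ) < t := ht
          simp only [Pi.zero_apply]
          positivity
  refine (mul_le_mul_right h2 _).trans (le_of_eq ?_)
  rw [← ENNReal.ofReal_mul hm0.le]
  congr 1
  have h3 : (m : ℝ) * Real.Gamma m = m ! := by
    rw [← Real.Gamma_add_one hm0.ne', Real.Gamma_nat_eq_factorial]
  rw [Real.rpow_natCast, ← h3, one_div, inv_pow]
  ring

theorem lintegral_comp_nat {R : Ω → ℕ} (hR : Measurable R) (f : ℕ → ℝ≥0∞) :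
    ∫⁻ ω, f (R ω) ∂Q = ∑' n, f n * Q {ω | R ω = n} := by
  rw [← lintegral_map (μ := Q) (f := f) measurable_from_top hR, lintegral_countable']
  refine tsum_congr fun n => ?_
  rw [Measure.map_apply hR (measurableSet_singleton n)]
  rfl

/-- Bounding `(n+1)^m` by `m! * choose (n+m) m` reduces the moment to the negative binomial series,
with sum `p^(-m-1)`. -/
theorem lintegral_geometric_succ_pow_le [IsFiniteMeasure Q] {R : Ω → ℕ} (hR : Measurable R)
    {p : ℝ} (hp0 : 0 < p) (hp1 : p ≤ 1)
    (hlaw : ∀ n : ℕ, Q.real {ω | R ω = n} = (1 - p) ^ n * p) (m : ℕ) :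
    ∫⁻ ω, ENNReal.ofReal (((R ω : ℝ) + 1) ^ m) ∂Q ≤ ENNReal.ofReal (m ! / p ^ m) := by
  have hq : 0 ≤ 1 - p := by linarith
  have hnorm : ‖1 - p‖ < 1 := by rw [Real.norm_of_nonneg hq]; linarith
  have hs := (hasSum_choose_mul_geometric_of_norm_lt_one m hnorm).mul_left (m ! * p)
  have hlaw' : ∀ n : ℕ, Q {ω | R ω = n} = ENNReal.ofReal ((1 - p) ^ n * p) := fun n => by
    rw [← hlaw n, ofReal_measureReal]
  rw [lintegral_comp_nat hR fun n => ENNReal.ofReal (((n : ℝ) + 1) ^ m)]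
  calc ∑' n : ℕ, ENNReal.ofReal (((n : ℝ) + 1) ^ m) * Q {ω | R ω = n}
      ≤ ∑' n : ℕ, ENNReal.ofReal (m ! * p * (((n + m).choose m : ℕ) * (1 - p) ^ n)) := by
        refine ENNReal.tsum_le_tsum fun n => ?_
        rw [hlaw', ← ENNReal.ofReal_mul (by positivity)]
        refine ENNReal.ofReal_le_ofReal ?_
        have h1 : ((n : ℝ) + 1) ^ m ≤ m ! * ((n + m).choose m : ℕ) := by
          have := Nat.pow_succ_le_ascFactorial (n + 1) m
          rw [Nat.ascFactorial_eq_factorial_mul_choose] at this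
          exact_mod_cast this
        calc ((n : ℝ) + 1) ^ m * ((1 - p) ^ n * p)
            ≤ (m ! * ((n + m).choose m : ℕ)) * ((1 - p) ^ n * p) := by gcongr
          _ = _ := by ring
    _ = ENNReal.ofReal (m ! / p ^ m) := by
        rw [← ENNReal.ofReal_tsum_of_nonneg (fun n => by positivity) hs.summable, hs.tsum_eq]
        congr 1
        rw [sub_sub_cancel, pow_succ]
        field_simp

theorem lintegral_geometric [IsFiniteMeasure Q] {R : Ω → ℕ} (hR : Measurable R)
    {p : ℝ} (hp0 : 0 < p) (hp1 : p ≤ 1)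
    (hlaw : ∀ n : ℕ, Q.real {ω | R ω = n} = (1 - p) ^ n * p) :
    ∫⁻ ω, (R ω : ℝ≥0∞) ∂Q = ENNReal.ofReal ((1 - p) / p) := by
  have hq : 0 ≤ 1 - p := by linarith
  have hnorm : ‖1 - p‖ < 1 := by rw [Real.norm_of_nonneg hq]; linarith
  have hs := (hasSum_coe_mul_geometric_of_norm_lt_one hnorm).mul_right p
  have hlaw' : ∀ n : ℕ, Q {ω | R ω = n} = ENNReal.ofReal ((1 - p) ^ n * p) := fun n => by
    rw [← hlaw n, ofReal_measureReal]
  rw [lintegral_comp_nat hR fun n => (n : ℝ≥0∞)]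
  calc ∑' n : ℕ, (n : ℝ≥0∞) * Q {ω | R ω = n}
      = ∑' n : ℕ, ENNReal.ofReal (n * (1 - p) ^ n * p) := by
        refine tsum_congr fun n => ?_
        rw [hlaw', ← ENNReal.ofReal_natCast, ← ENNReal.ofReal_mul (by positivity), mul_assoc]
    _ = ENNReal.ofReal ((1 - p) / p) := by
        rw [← ENNReal.ofReal_tsum_of_nonneg (fun n => by positivity) hs.summable, hs.tsum_eq]
        congr 1
        rw [sub_sub_cancel]
        field_simp

theorem sum_range_eq_tsum_ite (n : ℕ) (a : ℕ → ℝ≥0∞) :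
    ∑ i ∈ Finset.range n, a i = ∑' i, (if i < n then 1 else 0) * a i := by
  rw [tsum_eq_sum (s := Finset.range n)]
  · exact Finset.sum_congr rfl fun i hi => by rw [if_pos (Finset.mem_range.1 hi), one_mul]
  · intro i hi
    rw [if_neg (fun h => hi (Finset.mem_range.2 h)), zero_mul]

/-- A weighted form of Wald's identity for a random number of terms independent of the terms. -/
theorem lintegral_mul_sum_range {R : Ω → ℕ} {s : ℕ → Ω → ℝ} (hR : Measurable R)
    (hs : ∀ i, Measurable (s i)) (hind : ∀ i, IndepFun R (s i) Q) (w : ℕ → ℝ≥0∞)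
    {g : ℝ → ℝ≥0∞} (hg : Measurable g) :
    ∫⁻ ω, w (R ω) * ∑ i ∈ Finset.range (R ω), g (s i ω) ∂Q =
      ∑' i, (∫⁻ ω, w (R ω) * (if i < R ω then 1 else 0) ∂Q) * ∫⁻ ω, g (s i ω) ∂Q := by
  have hmeas : ∀ i : ℕ, Measurable fun n : ℕ => w n * (if i < n then (1 : ℝ≥0∞) else 0) :=
    fun i => measurable_from_top
  calc ∫⁻ ω, w (R ω) * ∑ i ∈ Finset.range (R ω), g (s i ω) ∂Q
      = ∫⁻ ω, ∑' i, (w (R ω) * (if i < R ω then 1 else 0)) * g (s i ω) ∂Q := by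
        refine lintegral_congr fun ω => ?_
        rw [sum_range_eq_tsum_ite, ← ENNReal.tsum_mul_left]
        exact tsum_congr fun i => (mul_assoc _ _ _).symm
    _ = ∑' i, ∫⁻ ω, (w (R ω) * (if i < R ω then 1 else 0)) * g (s i ω) ∂Q :=
        lintegral_tsum fun i =>
          (((hmeas i).comp hR).mul (hg.comp (hs i))).aemeasurable
    _ = _ := tsum_congr fun i =>
        lintegral_mul_eq_lintegral_mul_lintegral_of_indepFun ((hmeas i).comp hR)
          (hg.comp (hs i)) ((hind i).comp (hmeas i) hg)

theorem tsum_lintegral_mul_ite {R : Ω → ℕ} (hR : Measurable R) (w : ℕ → ℝ≥0∞) :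
    ∑' i : ℕ, ∫⁻ ω, w (R ω) * (if i < R ω then 1 else 0) ∂Q = ∫⁻ ω, w (R ω) * R ω ∂Q := by
  have hmeas : ∀ i : ℕ, Measurable fun n : ℕ => w n * (if i < n then (1 : ℝ≥0∞) else 0) :=
    fun i => measurable_from_top
  refine (lintegral_tsum fun i => ((hmeas i).comp hR).aemeasurable).symm.trans ?_
  refine lintegral_congr fun ω => ?_
  simp only [Function.comp_apply]
  rw [ENNReal.tsum_mul_left]
  congr 1
  have := sum_range_eq_tsum_ite (R ω) fun _ => 1
  simpa using this.symm

theorem measurable_totalTime {R : Ω → ℕ} {s : ℕ → Ω → ℝ} {τm : Ω → ℝ} (hR : Measurable R)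
    (hs : ∀ i, Measurable (s i)) (hτ : Measurable τm) : Measurable (totalTime R s τm) := by
  refine Measurable.add ?_ hτ
  have h : Measurable fun x : Ω × ℕ => ∑ i ∈ Finset.range x.2, s i x.1 :=
    measurable_from_prod_countable_left fun n =>
      Finset.measurable_sum (f := fun i ω => s i ω) (Finset.range n) fun i _ => hs i
  exact h.comp (measurable_id.prodMk hR)

/-- The resets carry the weight `(R+1)^(m-1) * R ≤ (R+1)^m`, hence `p^(-m)`; the final search
carries only `(R+1)^(m-1)`, hence `p^(-(m-1))`. -/
theorem lintegral_totalTime_pow_le [IsProbabilityMeasure Q] {R : Ω → ℕ} {s : ℕ → Ω → ℝ}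
    {τm : Ω → ℝ} (hR : Measurable R)
    (hs : ∀ i, Measurable (s i)) (hτ : Measurable τm) (hind : ∀ i, IndepFun R (s i) Q)
    (hindτ : IndepFun R τm Q) (hs0 : ∀ i, ∀ᵐ ω ∂Q, 0 ≤ s i ω) (hτ0 : ∀ᵐ ω ∂Q, 0 ≤ τm ω)
    {p : ℝ} (hp0 : 0 < p) (hp1 : p ≤ 1)
    (hlaw : ∀ n : ℕ, Q.real {ω | R ω = n} = (1 - p) ^ n * p) {m : ℕ} (hm : 1 ≤ m)
    {B B' : ℝ} (hB : 0 ≤ B) (hB' : 0 ≤ B')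
    (hsB : ∀ i, ∫⁻ ω, ENNReal.ofReal (s i ω ^ m) ∂Q ≤ ENNReal.ofReal B)
    (hτB : ∫⁻ ω, ENNReal.ofReal (τm ω ^ m) ∂Q ≤ ENNReal.ofReal B') :
    ∫⁻ ω, ENNReal.ofReal (totalTime R s τm ω ^ m) ∂Q ≤
      ENNReal.ofReal (m ! / p ^ m * B + (m - 1) ! / p ^ (m - 1) * B') := by
  set w : ℕ → ℝ≥0∞ := fun n => ENNReal.ofReal (((n : ℝ) + 1) ^ (m - 1)) with hw
  have hwm : Measurable w := measurable_from_top
  set g : ℝ → ℝ≥0∞ := fun x => ENNReal.ofReal (x ^ m) with hg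
  have hgm : Measurable g := by fun_prop
  have hpt : ∀ᵐ ω ∂Q, ENNReal.ofReal (totalTime R s τm ω ^ m) ≤
      w (R ω) * (∑ i ∈ Finset.range (R ω), g (s i ω)) + w (R ω) * g (τm ω) := by
    filter_upwards [ae_all_iff.2 hs0, hτ0] with ω h1 h2
    refine (ENNReal.ofReal_le_ofReal (totalTime_pow_le h1 h2 hm)).trans (le_of_eq ?_)
    rw [ENNReal.ofReal_mul (by positivity),
      ENNReal.ofReal_add (Finset.sum_nonneg fun i _ => pow_nonneg (h1 i) _) (by positivity),
      ENNReal.ofReal_sum_of_nonneg fun i _ => pow_nonneg (h1 i) _, mul_add]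
  have hwR : ∫⁻ ω, w (R ω) * R ω ∂Q ≤ ENNReal.ofReal (m ! / p ^ m) := by
    refine (lintegral_mono fun ω => ?_).trans (lintegral_geometric_succ_pow_le hR hp0 hp1 hlaw m)
    simp only [hw]
    rw [← ENNReal.ofReal_natCast, ← ENNReal.ofReal_mul (by positivity)]
    refine ENNReal.ofReal_le_ofReal ?_
    calc ((R ω : ℝ) + 1) ^ (m - 1) * R ω ≤ ((R ω : ℝ) + 1) ^ (m - 1) * (R ω + 1) := by
          gcongr; linarith
      _ = ((R ω : ℝ) + 1) ^ m := by rw [← pow_succ, Nat.sub_add_cancel hm]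
  have h1 : ∫⁻ ω, w (R ω) * ∑ i ∈ Finset.range (R ω), g (s i ω) ∂Q ≤
      ENNReal.ofReal (m ! / p ^ m * B) := by
    rw [lintegral_mul_sum_range hR hs hind w hgm]
    refine (ENNReal.tsum_le_tsum fun i => mul_le_mul_right (hsB i) _).trans ?_
    rw [ENNReal.tsum_mul_right, tsum_lintegral_mul_ite hR w, ENNReal.ofReal_mul (by positivity)]
    exact mul_le_mul_left hwR _
  have h2 : ∫⁻ ω, w (R ω) * g (τm ω) ∂Q ≤ ENNReal.ofReal ((m - 1) ! / p ^ (m - 1) * B') := by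
    have := lintegral_mul_eq_lintegral_mul_lintegral_of_indepFun (hwm.comp hR) (hgm.comp hτ)
      (hindτ.comp hwm hgm)
    refine this.le.trans ?_
    rw [ENNReal.ofReal_mul (by positivity)]
    exact mul_le_mul' (lintegral_geometric_succ_pow_le hR hp0 hp1 hlaw (m - 1)) hτB
  refine (lintegral_mono_ae hpt).trans ?_
  refine (lintegral_add_right _ ((hwm.comp hR).mul (hgm.comp hτ))).le.trans ?_
  rw [ENNReal.ofReal_add (by positivity) (by positivity)]
  exact add_le_add h1 h2

/-- Wald's identity after dropping `τm`. -/
theorem le_lintegral_totalTime [IsProbabilityMeasure Q] {R : Ω → ℕ} {s : ℕ → Ω → ℝ}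
    {τm : Ω → ℝ} (hR : Measurable R)
    (hs : ∀ i, Measurable (s i)) (hind : ∀ i, IndepFun R (s i) Q)
    (hs0 : ∀ i, ∀ᵐ ω ∂Q, 0 ≤ s i ω) (hτ0 : ∀ᵐ ω ∂Q, 0 ≤ τm ω)
    {p : ℝ} (hp0 : 0 < p) (hp1 : p ≤ 1)
    (hlaw : ∀ n : ℕ, Q.real {ω | R ω = n} = (1 - p) ^ n * p)
    {b : ℝ} (hsb : ∀ i, ENNReal.ofReal b ≤ ∫⁻ ω, ENNReal.ofReal (s i ω) ∂Q) :
    ENNReal.ofReal ((1 - p) / p * b) ≤ ∫⁻ ω, ENNReal.ofReal (totalTime R s τm ω) ∂Q := by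
  have hpt : ∀ᵐ ω ∂Q, 1 * (∑ i ∈ Finset.range (R ω), ENNReal.ofReal (s i ω)) ≤
      ENNReal.ofReal (totalTime R s τm ω) := by
    filter_upwards [ae_all_iff.2 hs0, hτ0] with ω h1 h2
    rw [one_mul, ← ENNReal.ofReal_sum_of_nonneg fun i _ => h1 i]
    exact ENNReal.ofReal_le_ofReal (le_add_of_nonneg_right h2)
  refine le_trans ?_ (lintegral_mono_ae hpt)
  rw [lintegral_mul_sum_range hR hs hind (fun _ => 1) ENNReal.measurable_ofReal]
  refine le_trans ?_ (ENNReal.tsum_le_tsum fun i => mul_le_mul_right (hsb i) _)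
  rw [ENNReal.tsum_mul_right, tsum_lintegral_mul_ite hR fun _ => 1]
  simp only [one_mul]
  rw [lintegral_geometric hR hp0 hp1 hlaw, ENNReal.ofReal_mul]
  exact div_nonneg (by linarith) hp0.le

end Moments

end StochasticResetting

namespace StochasticResetting

/-! ### Two-sided moment bounds for the search with resetting. -/

section Search

open scoped ENNReal Nat

variable {Ω₀ Ω : Type*} [MeasurableSpace Ω₀] [MeasurableSpace Ω] {P : Measure Ω₀}
  {τ : Ω₀ → EReal} {Y : Ω₀ → ℝ} {Q : Measure Ω}
  {R : Ω → ℕ} {σm : ℕ → Ω → ℝ} {τm : Ω → ℝ} {r : ℝ}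

/-- The probability `ℙ(σ < τ)` that the search is reset before it succeeds. -/
noncomputable def failProb (P : Measure Ω₀) (τ : Ω₀ → EReal) (σ : Ω₀ → ℝ) : ℝ :=
  P.real {ω | (σ ω : EReal) < τ ω}

theorem measurable_resetTime (hY : Measurable Y) (r : ℝ) : Measurable (resetTime Y r) :=
  hY.div_const r

theorem ae_resetTime_pos [IsProbabilityMeasure P] (hY : Measurable Y)
    (hYexp : ∀ y : ℝ, 0 ≤ y → P.real {ω | y < Y ω} = Real.exp (-y)) (hr : 0 < r) :
    ∀ᵐ ω ∂P, 0 < resetTime Y r ω := by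
  have h := measureReal_resetTime_gt hYexp hr le_rfl
  rw [mul_zero, neg_zero, Real.exp_zero] at h
  refine (mem_ae_iff_prob_eq_one
    (measurableSet_lt measurable_const (measurable_resetTime hY r))).2 ?_
  rw [← ENNReal.toReal_eq_one_iff]
  exact h

theorem ae_pos_of_cdfTime_zero (hF0 : cdfTime P τ 0 = 0) [IsProbabilityMeasure P] :
    ∀ᵐ ω ∂P, ((0 : ℝ) : EReal) < τ ω := by
  have h : P {ω | τ ω ≤ ((0 : ℝ) : EReal)} = 0 := (measureReal_eq_zero_iff).1 hF0
  rw [ae_iff]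
  simpa only [not_lt] using h

/-- Halving the rate doubles `σ`, so `τ ≤ σ` becomes the strict `τ < 2σ`. Hence `q → 1` follows from
`p → 0`, and ties `τ = σ` need no separate treatment. -/
theorem one_sub_failProb_le [IsProbabilityMeasure P] (hτ : Measurable τ) (hY : Measurable Y)
    (hYexp : ∀ y : ℝ, 0 ≤ y → P.real {ω | y < Y ω} = Real.exp (-y)) (hr : 0 < r) :
    1 - failProb P τ (resetTime Y r) ≤ successProb P τ (resetTime Y (r / 2)) := by
  have hσ := measurable_resetTime hY r
  have hms : MeasurableSet {ω | (resetTime Y r ω : EReal) < τ ω} :=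
    measurableSet_lt hσ.coe_real_ereal hτ
  rw [failProb, ← probReal_compl_eq_one_sub hms]
  refine ENNReal.toReal_mono (measure_ne_top _ _) (measure_mono_ae ?_)
  filter_upwards [ae_resetTime_pos hY hYexp hr] with ω hω h
  have h1 : τ ω ≤ resetTime Y r ω := not_lt.1 h
  refine lt_of_le_of_lt h1 (EReal.coe_lt_coe_iff.2 ?_)
  have : resetTime Y (r / 2) ω = 2 * resetTime Y r ω := by
    simp only [resetTime]; field_simp
  linarith

/-- The event `σ ≤ t < τ` has positive probability by independence. -/
theorem failProb_pos [IsProbabilityMeasure P] (hτ : Measurable τ) (hY : Measurable Y)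
    (hτY : IndepFun τ Y P)
    (hYexp : ∀ y : ℝ, 0 ≤ y → P.real {ω | y < Y ω} = Real.exp (-y)) (hr : 0 < r)
    {t : ℝ} (ht : 0 < t) (hFt : cdfTime P τ t < 1) :
    0 < failProb P τ (resetTime Y r) := by
  have h := hτY.measure_inter_preimage_eq_mul (Set.Ioi (t : EReal)) (Set.Iic (r * t))
    measurableSet_Ioi measurableSet_Iic
  have h1 : P.real (τ ⁻¹' Set.Ioi (t : EReal)) = 1 - cdfTime P τ t := by
    rw [cdfTime, ← probReal_compl_eq_one_sub (measurableSet_le hτ measurable_const)]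
    congr 1; ext ω; simp
  have h2 : P.real (Y ⁻¹' Set.Iic (r * t)) = 1 - Real.exp (-(r * t)) := by
    rw [← hYexp (r * t) (by positivity), ← probReal_compl_eq_one_sub
      (measurableSet_lt measurable_const hY)]
    congr 1; ext ω; simp
  have h3 : Real.exp (-(r * t)) < 1 := by
    rw [← Real.exp_zero]; exact Real.exp_lt_exp.2 (by nlinarith)
  have h4 : 0 < P.real (τ ⁻¹' Set.Ioi (t : EReal) ∩ Y ⁻¹' Set.Iic (r * t)) := by
    rw [measureReal_def, h, ENNReal.toReal_mul, ← measureReal_def, ← measureReal_def, h1, h2]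
    exact mul_pos (by linarith) (by linarith)
  refine h4.trans_le (measureReal_mono ?_)
  rintro ω ⟨ha, hb⟩
  refine lt_of_le_of_lt (EReal.coe_le_coe_iff.2 ?_) ha
  rw [resetTime, div_le_iff₀ hr, mul_comm]
  exact hb

theorem cond_le_ofReal [IsProbabilityMeasure P] {A B D : Set Ω₀} (hA : MeasurableSet A)
    (hpos : 0 < P.real A) (hsub : A ∩ B ⊆ D) :
    P[|A] B ≤ ENNReal.ofReal (1 / P.real A * P.real D) := by
  rw [cond_apply hA, ENNReal.ofReal_mul (by positivity), one_div,
    ENNReal.ofReal_inv_of_pos hpos, ofReal_measureReal, ofReal_measureReal]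
  exact mul_le_mul_right (measure_mono hsub) _

theorem cond_eq_one_of_ae [IsProbabilityMeasure P] {A B : Set Ω₀}
    (hpos : 0 < P.real A) (hB : MeasurableSet B) (hae : ∀ᵐ ω ∂P, ω ∈ B) : P[|A] B = 1 := by
  have : P A ≠ 0 := fun h => hpos.ne' (by rw [measureReal_def, h, ENNReal.toReal_zero])
  have := cond_isProbabilityMeasure this
  exact (mem_ae_iff_prob_eq_one hB).1 (cond_absolutelyContinuous.ae_le hae)

/-- Conditioning costs `1/q` in the tail of `σ⁻` and `1/p` in that of `τ⁻`; the latter restores the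
power of `p` missing from the final search, so both contributions are of order `p^(-m)`. The lower
bound is Jensen applied to the mean. -/
theorem IsResetSearch.moments [IsProbabilityMeasure P] [IsProbabilityMeasure Q]
    (h : IsResetSearch P τ (resetTime Y r) Q R σm τm) (hτ : Measurable τ) (hY : Measurable Y)
    (hF0 : cdfTime P τ 0 = 0)
    (hYexp : ∀ y : ℝ, 0 ≤ y → P.real {ω | y < Y ω} = Real.exp (-y)) (hr : 0 < r)
    {p q : ℝ} (hp : p = successProb P τ (resetTime Y r))
    (hq : q = failProb P τ (resetTime Y r)) (hp0 : 0 < p) (hq0 : 0 < q)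
    {m : ℕ} (hm : 1 ≤ m) :
    Integrable (fun ω => totalTime R σm τm ω ^ m) Q ∧
    r ^ m * ∫ ω, totalTime R σm τm ω ^ m ∂Q ≤ (m ! : ℝ) ^ 2 * (1 / q + 1) / p ^ m ∧
    (Real.exp (-1) - (1 - q) ≥ 0 →
      ((1 - p) / p * (Real.exp (-1) - (1 - q))) ^ m ≤
        r ^ m * ∫ ω, totalTime R σm τm ω ^ m ∂Q) := by
  have hp1 : p ≤ 1 := hp ▸ measureReal_le_one
  have hσ := measurable_resetTime hY r
  have hmA : MeasurableSet {ω | (resetTime Y r ω : EReal) < τ ω} :=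
    measurableSet_lt hσ.coe_real_ereal hτ
  have hmA' : MeasurableSet {ω | τ ω < (resetTime Y r ω : EReal)} :=
    measurableSet_lt hτ hσ.coe_real_ereal
  have hqA : 0 < P.real {ω | (resetTime Y r ω : EReal) < τ ω} := by
    rw [hq] at hq0; exact hq0
  have hpA : 0 < P.real {ω | τ ω < (resetTime Y r ω : EReal)} := by
    rw [hp] at hp0; exact hp0
  have hlaw : ∀ n : ℕ, Q.real {ω | R ω = n} = (1 - p) ^ n * p := hp ▸ h.law_R
  have hσpos : ∀ i, ∀ᵐ ω ∂Q, 0 ≤ σm i ω := fun i => by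
    have h1 : Q {ω | 0 < σm i ω} = 1 := by
      rw [h.law_σm i 0]
      exact cond_eq_one_of_ae hqA (measurableSet_lt measurable_const hσ)
        (ae_resetTime_pos hY hYexp hr)
    filter_upwards [(mem_ae_iff_prob_eq_one
      (measurableSet_lt measurable_const (h.measurable_σm i))).2 h1] with ω hω using le_of_lt hω
  have hτpos : ∀ᵐ ω ∂Q, 0 ≤ τm ω := by
    have h1 : Q {ω | 0 < τm ω} = 1 := by
      rw [h.law_τm 0]
      exact cond_eq_one_of_ae hpA (measurableSet_lt measurable_const hτ)
        (ae_pos_of_cdfTime_zero hF0)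
    filter_upwards [(mem_ae_iff_prob_eq_one
      (measurableSet_lt measurable_const h.measurable_τm)).2 h1] with ω hω using le_of_lt hω
  have hσtail : ∀ i t, 0 < t →
      Q {ω | t < σm i ω} ≤ ENNReal.ofReal (1 / q * Real.exp (-(r * t))) := by
    intro i t ht
    rw [h.law_σm i t, ← measureReal_resetTime_gt hYexp hr ht.le, hq]
    exact cond_le_ofReal hmA hqA Set.inter_subset_right
  have hτtail : ∀ t, 0 < t →
      Q {ω | t < τm ω} ≤ ENNReal.ofReal (1 / p * Real.exp (-(r * t))) := by
    intro t ht
    rw [h.law_τm t, ← measureReal_resetTime_gt hYexp hr ht.le, hp]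
    -- On `τ < σ`, `τ > t` forces `σ > t`, so `τ⁻` inherits the exponential tail.
    refine cond_le_ofReal hmA' hpA ?_
    rintro ω ⟨h1, h2⟩
    exact EReal.coe_lt_coe_iff.1 (lt_trans h2 h1)
  have hindσ : ∀ i, IndepFun R (σm i) Q := fun i =>
    h.indep_R.comp measurable_id
      ((measurable_pi_apply i).comp measurable_fst)
  have hindτ : IndepFun R τm Q :=
    h.indep_R.comp measurable_id measurable_snd
  have hTm := measurable_totalTime h.measurable_R h.measurable_σm h.measurable_τm
  have hT0 : ∀ᵐ ω ∂Q, 0 ≤ totalTime R σm τm ω := by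
    filter_upwards [ae_all_iff.2 hσpos, hτpos] with ω h1 h2 using totalTime_nonneg h1 h2
  have hup : ∀ k : ℕ, 1 ≤ k → ∫⁻ ω, ENNReal.ofReal (totalTime R σm τm ω ^ k) ∂Q ≤
      ENNReal.ofReal (k ! / p ^ k * (1 / q * k ! / r ^ k) +
        (k - 1) ! / p ^ (k - 1) * (1 / p * k ! / r ^ k)) := fun k hk =>
    lintegral_totalTime_pow_le h.measurable_R h.measurable_σm h.measurable_τm hindσ hindτ
      hσpos hτpos hp0 hp1 hlaw hk (by positivity) (by positivity)
      (fun i => lintegral_pow_le_of_exponential_tail (h.measurable_σm i) (hσpos i)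
        (by positivity) hr (hσtail i) hk)
      (lintegral_pow_le_of_exponential_tail h.measurable_τm hτpos (by positivity) hr hτtail hk)
  have hTk0 : ∀ k : ℕ, 0 ≤ᵐ[Q] fun ω => totalTime R σm τm ω ^ k := fun k => by
    filter_upwards [hT0] with ω hω using pow_nonneg hω k
  have hint : ∀ k : ℕ, 1 ≤ k → Integrable (fun ω => totalTime R σm τm ω ^ k) Q := fun k hk =>
    ⟨(hTm.pow_const k).aestronglyMeasurable, by
      rw [hasFiniteIntegral_iff_ofReal (hTk0 k)]
      exact (hup k hk).trans_lt ENNReal.ofReal_lt_top⟩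
  refine ⟨hint m hm, ?_, fun hb => ?_⟩
  · have h1 : ∫ ω, totalTime R σm τm ω ^ m ∂Q ≤ m ! / p ^ m * (1 / q * m ! / r ^ m) +
        (m - 1) ! / p ^ (m - 1) * (1 / p * m ! / r ^ m) := by
      rw [integral_eq_lintegral_of_nonneg_ae (hTk0 m) (hTm.pow_const m).aestronglyMeasurable]
      exact ENNReal.toReal_le_of_le_ofReal (by positivity) (hup m hm)
    have h2 : ((m - 1)! : ℝ) ≤ m ! := by
      exact_mod_cast Nat.factorial_le (Nat.sub_le m 1)
    have h3 : p ^ m = p ^ (m - 1) * p := by rw [← pow_succ, Nat.sub_add_cancel hm]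
    calc r ^ m * ∫ ω, totalTime R σm τm ω ^ m ∂Q
        ≤ r ^ m * (m ! / p ^ m * (1 / q * m ! / r ^ m) +
          m ! / p ^ (m - 1) * (1 / p * m ! / r ^ m)) := by
          refine mul_le_mul_of_nonneg_left (h1.trans ?_) (by positivity)
          gcongr
      _ = (m ! : ℝ) ^ 2 * (1 / q + 1) / p ^ m := by
          rw [h3]; field_simp
  -- Markov's inequality at level `1/r`, where `ℙ(σ > 1/r) = exp (-1)`; removing the complement of
  -- `σ < τ` costs at most `1 - q`.
  · have hσb : ∀ i, ENNReal.ofReal (1 / r * (Real.exp (-1) - (1 - q))) ≤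
        ∫⁻ ω, ENNReal.ofReal (σm i ω) ∂Q := by
      intro i
      have h1 : ENNReal.ofReal (Real.exp (-1) - (1 - q)) ≤ Q {ω | 1 / r < σm i ω} := by
        rw [h.law_σm i, cond_apply hmA]
        have h2 : Real.exp (-1) - (1 - q) ≤
            P.real ({ω | (resetTime Y r ω : EReal) < τ ω} ∩ {ω | 1 / r < resetTime Y r ω}) := by
          have h3 := measureReal_resetTime_gt hYexp hr (t := 1 / r) (by positivity)
          rw [mul_one_div_cancel hr.ne'] at h3
          have h4 := measureReal_union_add_inter (μ := P)
            (s := {ω | (resetTime Y r ω : EReal) < τ ω}) (t := {ω | 1 / r < resetTime Y r ω})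
            (measurableSet_lt measurable_const hσ)
          have h5 : P.real ({ω | (resetTime Y r ω : EReal) < τ ω} ∪
            {ω | 1 / r < resetTime Y r ω}) ≤ 1 := measureReal_le_one
          rw [failProb] at hq
          linarith
        refine (ENNReal.ofReal_le_ofReal h2).trans ?_
        rw [ofReal_measureReal]
        exact le_mul_of_one_le_left' (ENNReal.one_le_inv.2 prob_le_one)
      rw [ENNReal.ofReal_mul (by positivity)]
      refine (mul_le_mul_right h1 _).trans ?_
      refine le_trans (mul_le_mul_right (measure_mono fun ω hω => ?_) _)
        (mul_meas_ge_le_lintegral (h.measurable_σm i).ennreal_ofReal (ENNReal.ofReal (1 / r)))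
      exact ENNReal.ofReal_le_ofReal (le_of_lt hω)
    have h1 := le_lintegral_totalTime h.measurable_R h.measurable_σm hindσ hσpos hτpos hp0 hp1
      hlaw hσb
    have hint1 : Integrable (totalTime R σm τm) Q := by simpa using hint 1 le_rfl
    rw [← ofReal_integral_eq_lintegral_ofReal hint1 hT0,
      ENNReal.ofReal_le_ofReal_iff (integral_nonneg_of_ae hT0)] at h1
    have h2 : (∫ ω, totalTime R σm τm ω ∂Q) ^ m ≤ ∫ ω, totalTime R σm τm ω ^ m ∂Q :=
      (convexOn_pow m).map_integral_le (continuous_pow m).continuousOn isClosed_Ici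
        (by filter_upwards [hT0] with ω hω using hω) hint1 (hint m hm)
    have h3 : 0 ≤ (1 - p) / p := div_nonneg (by linarith) hp0.le
    calc ((1 - p) / p * (Real.exp (-1) - (1 - q))) ^ m
        = r ^ m * ((1 - p) / p * (1 / r * (Real.exp (-1) - (1 - q)))) ^ m := by
          rw [← mul_pow]; congr 1; field_simp
      _ ≤ r ^ m * (∫ ω, totalTime R σm τm ω ∂Q) ^ m := by
          gcongr
      _ ≤ _ := by gcongr

end Search

/-! ### From bounds to logarithmic equivalents. -/

theorem isEquivalent_mul_sqrt {f : ℝ → ℝ} {C a : ℝ} (hC : 0 < C) (ha : a ≠ 0)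
    (h : Tendsto (fun r => f r / √r) atTop (𝓝 (a * (2 * √C)))) :
    f ~[atTop] fun r => a * √(4 * C * r) := by
  have h4 : ∀ r, √(4 * C * r) = 2 * √C * √r := fun r => by
    rw [Real.sqrt_mul (by positivity), Real.sqrt_mul (by positivity)]
    congr 2
    rw [show (4 : ℝ) = 2 ^ 2 by norm_num, Real.sqrt_sq (by norm_num)]
  have hsC : 0 < √C := Real.sqrt_pos.2 hC
  have hb : a * (2 * √C) ≠ 0 := mul_ne_zero ha (by positivity)
  refine isEquivalent_of_tendsto_one ?_
  have h1 := h.div_const (a * (2 * √C))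
  rw [div_self hb] at h1
  refine h1.congr fun r => ?_
  simp only [Pi.div_apply]
  rw [h4, div_div]
  congr 1; ring

/-- Squeeze: `log K₁` and `log K₂` vanish after division by `√r`. -/
theorem tendsto_log_div_sqrt_of_bounds {p M : ℝ → ℝ} {D K₁ K₂ : ℝ} {m : ℕ} (hK₁ : 0 < K₁)
    (hK₂ : 0 < K₂)
    (hp : Tendsto (fun r => Real.log (p r) / √r) atTop (𝓝 (-D)))
    (hp0 : ∀ᶠ r in atTop, 0 < p r)
    (hlow : ∀ᶠ r in atTop, K₁ / p r ^ m ≤ M r) (hup : ∀ᶠ r in atTop, M r ≤ K₂ / p r ^ m) :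
    Tendsto (fun r => Real.log (M r) / √r) atTop (𝓝 (m * D)) := by
  have hlim : ∀ K : ℝ, Tendsto (fun r => Real.log K / √r - m * (Real.log (p r) / √r)) atTop
      (𝓝 (m * D)) := fun K => by
    have := (Real.tendsto_sqrt_atTop.const_div_atTop (Real.log K)).sub (hp.const_mul (m : ℝ))
    simpa using this
  have hlog : ∀ {K x : ℝ}, 0 < K → 0 < x → Real.log (K / x ^ m) = Real.log K - m * Real.log x :=
    fun hK hx => by rw [Real.log_div hK.ne' (by positivity), Real.log_pow]
  refine tendsto_of_tendsto_of_tendsto_of_le_of_le' (hlim K₁) (hlim K₂) ?_ ?_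
  · filter_upwards [hp0, hlow] with r h0 h1
    rw [← mul_div_assoc, ← sub_div, ← hlog hK₁ h0]
    exact div_le_div_of_nonneg_right (Real.log_le_log (by positivity) h1) (Real.sqrt_nonneg _)
  · filter_upwards [hp0, hlow, hup] with r h0 h1 h2
    rw [← mul_div_assoc, ← sub_div, ← hlog hK₂ h0]
    have : 0 < K₁ / p r ^ m := by positivity
    exact div_le_div_of_nonneg_right (Real.log_le_log (by linarith) h2) (Real.sqrt_nonneg _)

theorem tendsto_zero_of_tendsto_log_div_sqrt {p : ℝ → ℝ} {D : ℝ} (hD : 0 < D)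
    (hp0 : ∀ r, 0 < r → 0 < p r)
    (hp : Tendsto (fun r => Real.log (p r) / √r) atTop (𝓝 (-D))) :
    Tendsto p atTop (𝓝 0) := by
  have h1 : Tendsto (fun r => Real.log (p r) / √r * √r) atTop atBot :=
    hp.neg_mul_atTop (neg_lt_zero.2 hD) Real.tendsto_sqrt_atTop
  refine (Real.tendsto_exp_atBot.comp h1).congr' ?_
  filter_upwards [eventually_gt_atTop 0] with r hr
  rw [Function.comp_apply, div_mul_cancel₀ _ (Real.sqrt_pos.2 hr).ne', Real.exp_log (hp0 r hr)]

end StochasticResetting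

theorem theorem2
    -- the search time `τ ∈ (0, ∞]` without resetting, and the unit-mean exponential variable `Y`
    {Ω₀ : Type*} [MeasurableSpace Ω₀] (P : Measure Ω₀) [IsProbabilityMeasure P]
    (τ : Ω₀ → EReal) (Y : Ω₀ → ℝ) (hτ : Measurable τ) (hY : Measurable Y)
    (hτY : IndepFun τ Y P)
    (hF0 : StochasticResetting.cdfTime P τ 0 = 0)
    (hYexp : ∀ y : ℝ, 0 ≤ y → P.real {ω | y < Y ω} = Real.exp (-y))
    -- for each rate `r > 0`, a realization of the search with resetting
    {Ω : ℝ → Type*} [∀ r, MeasurableSpace (Ω r)] (Q : ∀ r, Measure (Ω r))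
    [∀ r, IsProbabilityMeasure (Q r)]
    (R : ∀ r, Ω r → ℕ) (σm : ∀ r, ℕ → Ω r → ℝ) (τm : ∀ r, Ω r → ℝ)
    (hT : ∀ r : ℝ, 0 < r → StochasticResetting.IsResetSearch P τ
      (StochasticResetting.resetTime Y r) (Q r) (R r) (σm r) (τm r))
    (C : ℝ) (hC : 0 < C)
    (hlim : Tendsto (fun t : ℝ => t * Real.log (StochasticResetting.cdfTime P τ t))
      (𝓝[>] 0) (𝓝 (-C))) :
    (fun r : ℝ => Real.log
        (StochasticResetting.successProb P τ (StochasticResetting.resetTime Y r)))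
      ~[atTop] (fun r : ℝ => -√(4 * C * r)) ∧
    ∀ m : ℕ, 1 ≤ m →
      (∀ r : ℝ, 0 < r → Integrable
        (fun ω => StochasticResetting.totalTime (R r) (σm r) (τm r) ω ^ m) (Q r)) ∧
      (fun r : ℝ => Real.log
          (r ^ m * ∫ ω, StochasticResetting.totalTime (R r) (σm r) (τm r) ω ^ m ∂(Q r)))
        ~[atTop] (fun r : ℝ => m * √(4 * C * r)) := by
  have hFpos : ∀ t, 0 < t → 0 < StochasticResetting.cdfTime P τ t := fun t ht =>
    StochasticResetting.pos_of_tendsto_mul_log hC StochasticResetting.cdfTime_mono (fun _ => measureReal_nonneg) hlim ht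
  -- `t * log (F t) < 0` for some small `t > 0` forces `F t < 1`, so a reset has positive
  -- probability.
  obtain ⟨t₀, ht₀, hFt₀⟩ : ∃ t : ℝ, 0 < t ∧ StochasticResetting.cdfTime P τ t < 1 := by
    have h1 := hlim.eventually (gt_mem_nhds (neg_lt_zero.2 hC))
    obtain ⟨t, ht, ht0⟩ := (h1.and self_mem_nhdsWithin).exists
    exact ⟨t, ht0, not_le.1 fun h => not_le.2 ht (mul_nonneg (le_of_lt ht0) (Real.log_nonneg h))⟩
  set p : ℝ → ℝ := fun r =>
    StochasticResetting.successProb P τ (StochasticResetting.resetTime Y r) with hpdef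
  set q : ℝ → ℝ := fun r =>
    StochasticResetting.failProb P τ (StochasticResetting.resetTime Y r) with hqdef
  have hlow : ∀ r t : ℝ, 0 < r → 0 < t →
      StochasticResetting.cdfTime P τ t * Real.exp (-(r * t)) ≤ p r := fun r t hr ht =>
    StochasticResetting.cdfTime_mul_exp_le_successProb hτY hYexp hr ht
  have hp0 : ∀ r, 0 < r → 0 < p r := fun r hr =>
    (mul_pos (hFpos 1 one_pos) (Real.exp_pos _)).trans_le (hlow r 1 hr one_pos)
  have hq0 : ∀ r, 0 < r → 0 < q r := fun r hr =>
    StochasticResetting.failProb_pos hτ hY hτY hYexp hr ht₀ hFt₀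
  have hp := StochasticResetting.tendsto_log_div_sqrt (p := p) hC hlim hFpos hlow
    fun r N hr => StochasticResetting.successProb_le hτY hF0 hYexp N hr
  have hD : 0 < 2 * √C := by positivity
  have hpz := StochasticResetting.tendsto_zero_of_tendsto_log_div_sqrt hD hp0 hp
  have hexp : (1 : ℝ) / 3 < Real.exp (-1) := by
    rw [Real.exp_neg, one_div]
    exact inv_strictAnti₀ (Real.exp_pos 1) (by linarith [Real.exp_one_lt_d9])
  -- `1/12` leaves `exp (-1) - (1 - q) > 1/4`; together with `1 - p > 1/2` this gives the `1/8` in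
  -- `K₁`. It also gives `1/q ≤ 2`, hence the `3` in `K₂`.
  have hqlow : ∀ᶠ r in atTop, 1 - q r < 1 / 12 := by
    have h1 := (hpz.comp (tendsto_id.atTop_div_const (by norm_num : (0 : ℝ) < 2))).eventually
      (gt_mem_nhds (by norm_num : (0 : ℝ) < 1 / 12))
    filter_upwards [h1, eventually_gt_atTop 0] with r hr hr0
    exact (StochasticResetting.one_sub_failProb_le hτ hY hYexp hr0).trans_lt hr
  refine ⟨?_, fun m hm => ⟨fun r hr => ((hT r hr).moments hτ hY hF0 hYexp hr rfl rfl (hp0 r hr)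
    (hq0 r hr) hm).1, ?_⟩⟩
  · have h := StochasticResetting.isEquivalent_mul_sqrt (a := -1) hC (by norm_num)
      (by rwa [neg_one_mul])
    simpa only [neg_one_mul] using h
  · refine StochasticResetting.isEquivalent_mul_sqrt hC (by positivity)
      (StochasticResetting.tendsto_log_div_sqrt_of_bounds (p := p)
        (K₁ := (1 / 8) ^ m) (K₂ := (m.factorial : ℝ) ^ 2 * 3) (by positivity) (by positivity) hp
        ?_ ?_ ?_)
    · filter_upwards [eventually_gt_atTop 0] with r hr using hp0 r hr
    · filter_upwards [eventually_gt_atTop 0, hqlow,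
        hpz.eventually (gt_mem_nhds (by norm_num : (0 : ℝ) < 1 / 2))] with r hr h1 h2
      refine le_trans ?_ (((hT r hr).moments hτ hY hF0 hYexp hr rfl rfl (hp0 r hr)
        (hq0 r hr) hm).2.2 (by linarith))
      rw [← div_pow]
      have hpr := hp0 r hr
      refine pow_le_pow_left₀ (by positivity) ?_ m
      change 1 / 8 / p r ≤ (1 - p r) / p r * (Real.exp (-1) - (1 - q r))
      rw [div_mul_eq_mul_div]
      refine div_le_div_of_nonneg_right ?_ hpr.le
      nlinarith
    · filter_upwards [eventually_gt_atTop 0, hqlow] with r hr h1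
      refine ((hT r hr).moments hτ hY hF0 hYexp hr rfl rfl (hp0 r hr)
        (hq0 r hr) hm).2.1.trans ?_
      have hpr := hp0 r hr
      have h2 : 1 / q r ≤ 2 := by
        rw [div_le_iff₀ (hq0 r hr)]; linarith
      change (m.factorial : ℝ) ^ 2 * (1 / q r + 1) / p r ^ m ≤ _
      gcongr
      linarith
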